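/- For a set $X$ let $\mathbb{N}[X]$ be the underlying set of the free commutative monoid on $X$ (finite formal sums of elements of $X$ with natural number coefficients, ordered coefficientwise), and for a function $f\colon X\to Y$ let $\mathbb{N}[f]\colon\mathbb{N}[X]\to\mathbb{N}[Y]$ be its additive extension. A Petri net $P$ is a pair of functions $s,t\colon T\to\mathbb{N}[S]$, where $T$ is the set of transitions and $S$ the set of places. A morphism from $(s,t\colon T\to\mathbb{N}[S])$ to $(s',t'\colon T'\to\mathbb{N}[S'])$ is a pair of functions $f\colon T\to T'$, $g\colon S\to S'$ with $s'f=\mathbb{N}[g]s$ and $t'f=\mathbb{N}[g]t$. This defines a category $\mathsf{Petri}$. Let $L\colon\mathsf{Set}\to\mathsf{Petri}$ be the functor sending $X$ to the Petri net with set of places $X$ and no transitions. An open Petri net $P\colon X\nrightarrow Y$ is a cospan $LX\xrightarrow{\,i\,}P\xleftarrow{\,o\,}LY$ in $\mathsf{Petri}$. Double categories are pseudo double categories (categories weakly internal to $\mathsf{Cat}$). Let $\mathbb{O}\mathbf{pen}(\mathsf{Petri})$ be the double category whose objects are sets, whose vertical 1-morphisms are functions, whose horizontal 1-cells $X\nrightarrow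 Y$ are open Petri nets, composed by pushout in $\mathsf{Petri}$ (with unit $LX\xrightarrow{1}LX\xleftarrow{1}LX$), and whose 2-morphisms $P\Rightarrow P'$ are triples of functions $f\colon X\to X'$, $g\colon Y\to Y'$ and a Petri net morphism $\alpha\colon P\to P'$ with $\alpha i=i'\circ Lf$ and $\alpha o=o'\circ Lg$. Let $\mathbb{R}\mathbf{el}$ be the double category whose objects are sets, whose vertical 1-morphisms are functions, whose horizontal 1-cells from $X$ to $Y$ are relations $R\subseteq X\times Y$ with their usual composition, and whose 2-morphisms from $R\subseteq X\times Y$ to $R'\subseteq X'\times Y'$ are pairs of functions $f\colon X\to X'$, $g\colon Y\to Y'$ with $(f\times g)R\subseteq R'$. A marking of $P=(s,t\colon T\to\mathbb{N}[S])$ is an element of $\mathbb{N}[S]$. A firing of $\tau\in T$ is a triple $(\tau,m,n)$ with markings $m\ge s(\tau)$ and $n+s(\tau)=m+t(\tau)$. A marking $n$ is reachable from $m$ if there are $k\ge 1$, markings $m=m_1,\dots,m_k=n$ and firings $(\tau_j,m_j,m_{j+1})$ for $1\le j<k$. The reachability relation of an open Petri net $LX\xrightarrow{\,i\,}P\xleftarrow{\,o\,}LY$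 is $$\blacksquare P=\{(x,y)\in\mathbb{N}[X]\times\mathbb{N}[Y] : o(y)\text{ is reachable from } i(x)\},$$ where $i$ and $o$ also denote the maps $\mathbb{N}[X]\to\mathbb{N}[S]$ and $\mathbb{N}[Y]\to\mathbb{N}[S]$ induced on markings. **Theorem.** There is a lax double functor $\blacksquare\colon\mathbb{O}\mathbf{pen}(\mathsf{Petri})\to\mathbb{R}\mathbf{el}$ (functors on the categories of objects and on the categories of arrows, compatible with source and target, together with natural globular comparison 2-morphisms $\blacksquare Q\odot\blacksquare P\Rightarrow\blacksquare(Q\odot P)$ and $U_{\blacksquare X}\Rightarrow\blacksquare(U_X)$, not required to be invertible, which are compatible with the associator and the unitors) that sends * every set $X$ to $\mathbb{N}[X]$, * every function $f$ to $\mathbb{N}[f]$, * every open Petri net $LX\to P\leftarrow LY$ to its reachability relation $\blacksquare P$, * every 2-morphism $P\Rightarrow P'$ with vertical sides $f\colon X\to X'$ and $g\colon Y\to Y'$ to the square in $\mathbb{R}\mathbf{el}$ with vertical sides $\mathbb{N}[f]$ and $\mathbb{N}[g]$; in particular $(\mathbb{N}[f]\times\mathbb{N}[g])\,\blacksquare P\subseteq\blacksquare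 P'$. In particular, for all open Petri nets $P\colon X\nrightarrow Y$ and $Q\colon Y\nrightarrow Z$, the composite relation $\blacksquare Q\odot\blacksquare P=\{(x,z) : \exists y,\ (x,y)\in\blacksquare P,\ (y,z)\in\blacksquare Q\}$ is contained in $\blacksquare(Q\odot P)$. -/

import Mathlib

open CategoryTheory CategoryTheory.Limits

universe u v w t u' v' w' t'

namespace OpenPetriNets

/-! ### Double categories -/

set_option linter.checkUnivs false in
/-- A (pseudo) double category with category of objects `D₀`: a category weakly internal to `Cat`.

The category of arrows `D₁` is given in fibred form. Its objects with source `a` and target `b` (the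
horizontal 1-cells from `a` to `b`) form the type `Hor a b`, so that an object of `D₁` is a triple
`(a, b, M)` with `M : Hor a b`. A morphism of `D₁` from `M` to `N` (a 2-morphism) is an element of
`Cell M N`; composition in `D₁` is `vcomp`, written in diagrammatic order. The source and target
functors are `(a, b, M) ↦ a, b` on objects and `src`, `tgt` on morphisms. As for the functor
`⊙ : D₁ ×_{D₀} D₁ → D₁`, `hcomp N M` is `N ⊙ M` (first `M`, then `N`) and `hcompCell β α h` is
`β ⊙ α`, which makes sense under `h : tgt α = src β`. -/
structure DoubleCategory (D₀ : Type u) [Category.{v} D₀] where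
  /-- Horizontal 1-cells. -/
  Hor : D₀ → D₀ → Type w
  /-- 2-morphisms. -/
  Cell : ∀ {a b c d : D₀}, Hor a b → Hor c d → Type t
  -- the category of arrows
  vid : ∀ {a b : D₀} (M : Hor a b), Cell M M
  vcomp : ∀ {a b c d e f : D₀} {M : Hor a b} {N : Hor c d} {P : Hor e f},
    Cell M N → Cell N P → Cell M P
  vid_vcomp : ∀ {a b c d : D₀} {M : Hor a b} {N : Hor c d} (α : Cell M N),
    vcomp (vid M) α = α
  vcomp_vid : ∀ {a b c d : D₀} {M : Hor a b} {N : Hor c d} (α : Cell M N),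
    vcomp α (vid N) = α
  vassoc : ∀ {a b c d e f g h : D₀} {M : Hor a b} {N : Hor c d} {P : Hor e f} {Q : Hor g h}
    (α : Cell M N) (β : Cell N P) (γ : Cell P Q),
    vcomp (vcomp α β) γ = vcomp α (vcomp β γ)
  -- the source functor and the target functor
  src : ∀ {a b c d : D₀} {M : Hor a b} {N : Hor c d}, Cell M N → (a ⟶ c)
  tgt : ∀ {a b c d : D₀} {M : Hor a b} {N : Hor c d}, Cell M N → (b ⟶ d)
  src_vid : ∀ {a b : D₀} (M : Hor a b), src (vid M) = 𝟙 a
  tgt_vid : ∀ {a b : D₀} (M : Hor a b), tgt (vid M) = 𝟙 b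
  src_vcomp : ∀ {a b c d e f : D₀} {M : Hor a b} {N : Hor c d} {P : Hor e f}
    (α : Cell M N) (β : Cell N P), src (vcomp α β) = src α ≫ src β
  tgt_vcomp : ∀ {a b c d e f : D₀} {M : Hor a b} {N : Hor c d} {P : Hor e f}
    (α : Cell M N) (β : Cell N P), tgt (vcomp α β) = tgt α ≫ tgt β
  -- the identity-assigning functor
  U : ∀ a : D₀, Hor a a
  UMap : ∀ {a b : D₀}, (a ⟶ b) → Cell (U a) (U b)
  src_UMap : ∀ {a b : D₀} (f : a ⟶ b), src (UMap f) = f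
  tgt_UMap : ∀ {a b : D₀} (f : a ⟶ b), tgt (UMap f) = f
  UMap_id : ∀ a : D₀, UMap (𝟙 a) = vid (U a)
  UMap_comp : ∀ {a b c : D₀} (f : a ⟶ b) (g : b ⟶ c), UMap (f ≫ g) = vcomp (UMap f) (UMap g)
  -- the composition functor
  hcomp : ∀ {a b c : D₀}, Hor b c → Hor a b → Hor a c
  hcompCell : ∀ {a b c a' b' c' : D₀} {N : Hor b c} {M : Hor a b} {N' : Hor b' c'} {M' : Hor a' b'}
    (β : Cell N N') (α : Cell M M'), tgt α = src β → Cell (hcomp N M) (hcomp N' M')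
  src_hcompCell : ∀ {a b c a' b' c' : D₀} {N : Hor b c} {M : Hor a b} {N' : Hor b' c'}
    {M' : Hor a' b'} (β : Cell N N') (α : Cell M M') (h : tgt α = src β),
    src (hcompCell β α h) = src α
  tgt_hcompCell : ∀ {a b c a' b' c' : D₀} {N : Hor b c} {M : Hor a b} {N' : Hor b' c'}
    {M' : Hor a' b'} (β : Cell N N') (α : Cell M M') (h : tgt α = src β),
    tgt (hcompCell β α h) = tgt β
  hcompCell_vid : ∀ {a b c : D₀} (N : Hor b c) (M : Hor a b),
    hcompCell (vid N) (vid M) ((tgt_vid M).trans (src_vid N).symm) = vid (hcomp N M)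
  hcompCell_vcomp : ∀ {a b c a' b' c' a'' b'' c'' : D₀} {N : Hor b c} {M : Hor a b}
    {N' : Hor b' c'} {M' : Hor a' b'} {N'' : Hor b'' c''} {M'' : Hor a'' b''}
    (β : Cell N N') (α : Cell M M') (β' : Cell N' N'') (α' : Cell M' M'')
    (h : tgt α = src β) (h' : tgt α' = src β'),
    hcompCell (vcomp β β') (vcomp α α')
      ((tgt_vcomp α α').trans ((congrArg₂ (· ≫ ·) h h').trans (src_vcomp β β').symm)) =
      vcomp (hcompCell β α h) (hcompCell β' α' h')
  -- the associator
  assoc : ∀ {a b c d : D₀} (P : Hor c d) (N : Hor b c) (M : Hor a b),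
    Cell (hcomp (hcomp P N) M) (hcomp P (hcomp N M))
  assocInv : ∀ {a b c d : D₀} (P : Hor c d) (N : Hor b c) (M : Hor a b),
    Cell (hcomp P (hcomp N M)) (hcomp (hcomp P N) M)
  assoc_assocInv : ∀ {a b c d : D₀} (P : Hor c d) (N : Hor b c) (M : Hor a b),
    vcomp (assoc P N M) (assocInv P N M) = vid _
  assocInv_assoc : ∀ {a b c d : D₀} (P : Hor c d) (N : Hor b c) (M : Hor a b),
    vcomp (assocInv P N M) (assoc P N M) = vid _
  src_assoc : ∀ {a b c d : D₀} (P : Hor c d) (N : Hor b c) (M : Hor a b), src (assoc P N M) = 𝟙 a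
  tgt_assoc : ∀ {a b c d : D₀} (P : Hor c d) (N : Hor b c) (M : Hor a b), tgt (assoc P N M) = 𝟙 d
  assoc_naturality : ∀ {a b c d a' b' c' d' : D₀} {P : Hor c d} {N : Hor b c} {M : Hor a b}
    {P' : Hor c' d'} {N' : Hor b' c'} {M' : Hor a' b'}
    (γ : Cell P P') (β : Cell N N') (α : Cell M M') (h : tgt β = src γ) (h' : tgt α = src β),
    vcomp (hcompCell (hcompCell γ β h) α (h'.trans (src_hcompCell γ β h).symm)) (assoc P' N' M') =
      vcomp (assoc P N M) (hcompCell γ (hcompCell β α h') ((tgt_hcompCell β α h').trans h))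
  -- the left unitor
  lunit : ∀ {a b : D₀} (M : Hor a b), Cell (hcomp (U b) M) M
  lunitInv : ∀ {a b : D₀} (M : Hor a b), Cell M (hcomp (U b) M)
  lunit_lunitInv : ∀ {a b : D₀} (M : Hor a b), vcomp (lunit M) (lunitInv M) = vid _
  lunitInv_lunit : ∀ {a b : D₀} (M : Hor a b), vcomp (lunitInv M) (lunit M) = vid _
  src_lunit : ∀ {a b : D₀} (M : Hor a b), src (lunit M) = 𝟙 a
  tgt_lunit : ∀ {a b : D₀} (M : Hor a b), tgt (lunit M) = 𝟙 b
  lunit_naturality : ∀ {a b c d : D₀} {M : Hor a b} {N : Hor c d} (α : Cell M N),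
    vcomp (hcompCell (UMap (tgt α)) α (src_UMap (tgt α)).symm) (lunit N) = vcomp (lunit M) α
  -- the right unitor
  runit : ∀ {a b : D₀} (M : Hor a b), Cell (hcomp M (U a)) M
  runitInv : ∀ {a b : D₀} (M : Hor a b), Cell M (hcomp M (U a))
  runit_runitInv : ∀ {a b : D₀} (M : Hor a b), vcomp (runit M) (runitInv M) = vid _
  runitInv_runit : ∀ {a b : D₀} (M : Hor a b), vcomp (runitInv M) (runit M) = vid _
  src_runit : ∀ {a b : D₀} (M : Hor a b), src (runit M) = 𝟙 a
  tgt_runit : ∀ {a b : D₀} (M : Hor a b), tgt (runit M) = 𝟙 b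
  runit_naturality : ∀ {a b c d : D₀} {M : Hor a b} {N : Hor c d} (α : Cell M N),
    vcomp (hcompCell α (UMap (src α)) (tgt_UMap (src α))) (runit N) = vcomp (runit M) α
  -- coherence
  pentagon : ∀ {a b c d e : D₀} (Q : Hor d e) (P : Hor c d) (N : Hor b c) (M : Hor a b),
    vcomp
      (vcomp
        (hcompCell (assoc Q P N) (vid M) ((tgt_vid M).trans (src_assoc Q P N).symm))
        (assoc Q (hcomp P N) M))
      (hcompCell (vid Q) (assoc P N M) ((tgt_assoc P N M).trans (src_vid Q).symm)) =
    vcomp (assoc (hcomp Q P) N M) (assoc Q P (hcomp N M))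
  triangle : ∀ {a b c : D₀} (N : Hor b c) (M : Hor a b),
    vcomp (assoc N (U b) M)
      (hcompCell (vid N) (lunit M) ((tgt_lunit M).trans (src_vid N).symm)) =
    hcompCell (runit N) (vid M) ((tgt_vid M).trans (src_runit N).symm)

/-- The action of a lax double functor on objects, vertical 1-morphisms and horizontal 1-cells:
a functor `F₀` between categories of objects, and a map of horizontal 1-cells (the object part of
`F₁`) compatible with sources and targets. -/
structure OneCellMap {A₀ : Type u} [Category.{v} A₀] {B₀ : Type u'} [Category.{v'} B₀]
    (A : DoubleCategory.{u, v, w, t} A₀) (B : DoubleCategory.{u', v', w', t'} B₀) where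
  /-- The functor `F₀`. -/
  F₀ : A₀ ⥤ B₀
  /-- The functor `F₁` on horizontal 1-cells. -/
  hor : ∀ {a b : A₀}, A.Hor a b → B.Hor (F₀.obj a) (F₀.obj b)

/-- Lax double functors: `F₁` is given by `hor` on horizontal 1-cells and by `cell` on 2-morphisms,
`compar N M : F₁ N ⊙ F₁ M ⟶ F₁ (N ⊙ M)` is the composition comparison and
`unitCompar a : U (F₀ a) ⟶ F₁ (U a)` the identity comparison. -/
structure LaxDoubleFunctor {A₀ : Type u} [Category.{v} A₀] {B₀ : Type u'} [Category.{v'} B₀]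
    (A : DoubleCategory.{u, v, w, t} A₀) (B : DoubleCategory.{u', v', w', t'} B₀)
    extends OneCellMap A B where
  /-- The functor `F₁` on 2-morphisms. -/
  cell : ∀ {a b c d : A₀} {M : A.Hor a b} {N : A.Hor c d}, A.Cell M N → B.Cell (hor M) (hor N)
  cell_vid : ∀ {a b : A₀} (M : A.Hor a b), cell (A.vid M) = B.vid (hor M)
  cell_vcomp : ∀ {a b c d e f : A₀} {M : A.Hor a b} {N : A.Hor c d} {P : A.Hor e f}
    (α : A.Cell M N) (β : A.Cell N P), cell (A.vcomp α β) = B.vcomp (cell α) (cell β)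
  src_cell : ∀ {a b c d : A₀} {M : A.Hor a b} {N : A.Hor c d} (α : A.Cell M N),
    B.src (cell α) = F₀.map (A.src α)
  tgt_cell : ∀ {a b c d : A₀} {M : A.Hor a b} {N : A.Hor c d} (α : A.Cell M N),
    B.tgt (cell α) = F₀.map (A.tgt α)
  -- the composition comparison
  compar : ∀ {a b c : A₀} (N : A.Hor b c) (M : A.Hor a b),
    B.Cell (B.hcomp (hor N) (hor M)) (hor (A.hcomp N M))
  src_compar : ∀ {a b c : A₀} (N : A.Hor b c) (M : A.Hor a b), B.src (compar N M) = 𝟙 (F₀.obj a)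
  tgt_compar : ∀ {a b c : A₀} (N : A.Hor b c) (M : A.Hor a b), B.tgt (compar N M) = 𝟙 (F₀.obj c)
  compar_naturality : ∀ {a b c a' b' c' : A₀} {N : A.Hor b c} {M : A.Hor a b}
    {N' : A.Hor b' c'} {M' : A.Hor a' b'} (β : A.Cell N N') (α : A.Cell M M')
    (h : A.tgt α = A.src β),
    B.vcomp
      (B.hcompCell (cell β) (cell α)
        ((tgt_cell α).trans ((congrArg F₀.map h).trans (src_cell β).symm)))
      (compar N' M') =
    B.vcomp (compar N M) (cell (A.hcompCell β α h))
  -- the identity comparison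
  unitCompar : ∀ a : A₀, B.Cell (B.U (F₀.obj a)) (hor (A.U a))
  src_unitCompar : ∀ a : A₀, B.src (unitCompar a) = 𝟙 (F₀.obj a)
  tgt_unitCompar : ∀ a : A₀, B.tgt (unitCompar a) = 𝟙 (F₀.obj a)
  unitCompar_naturality : ∀ {a b : A₀} (f : a ⟶ b),
    B.vcomp (B.UMap (F₀.map f)) (unitCompar b) = B.vcomp (unitCompar a) (cell (A.UMap f))
  -- compatibility with the associator and the unitors
  compar_assoc : ∀ {a b c d : A₀} (P : A.Hor c d) (N : A.Hor b c) (M : A.Hor a b),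
    B.vcomp
      (B.vcomp
        (B.hcompCell (compar P N) (B.vid (hor M))
          ((B.tgt_vid (hor M)).trans (src_compar P N).symm))
        (compar (A.hcomp P N) M))
      (cell (A.assoc P N M)) =
    B.vcomp
      (B.vcomp
        (B.assoc (hor P) (hor N) (hor M))
        (B.hcompCell (B.vid (hor P)) (compar N M)
          ((tgt_compar N M).trans (B.src_vid (hor P)).symm)))
      (compar P (A.hcomp N M))
  compar_runit : ∀ {a b : A₀} (M : A.Hor a b),
    B.vcomp
      (B.vcomp
        (B.hcompCell (B.vid (hor M)) (unitCompar a)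
          ((tgt_unitCompar a).trans (B.src_vid (hor M)).symm))
        (compar M (A.U a)))
      (cell (A.runit M)) =
    B.runit (hor M)
  compar_lunit : ∀ {a b : A₀} (M : A.Hor a b),
    B.vcomp
      (B.vcomp
        (B.hcompCell (unitCompar b) (B.vid (hor M))
          ((B.tgt_vid (hor M)).trans (src_unitCompar b).symm))
        (compar (A.U b) M))
      (cell (A.lunit M)) =
    B.lunit (hor M)

/-! ### The double category of relations -/

/-- A 2-morphism in `Rel` from `R ⊆ X₁ × Y₁` to `S ⊆ X₂ × Y₂`: functions `f : X₁ → X₂` and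
`g : Y₁ → Y₂` with `(f × g) R ⊆ S`. -/
@[ext]
structure RelSquare {X₁ Y₁ X₂ Y₂ : Type u} (R : SetRel X₁ Y₁) (S : SetRel X₂ Y₂) where
  left : X₁ ⟶ X₂
  right : Y₁ ⟶ Y₂
  image_subset : Prod.map left right '' R ⊆ S

/-- The double category of sets, functions, relations and squares `(f × g) R ⊆ S`; the horizontal
composite of `M ⊆ X × Y` and `N ⊆ Y × Z` is the usual composite of relations
`{(x, z) | ∃ y, (x, y) ∈ M ∧ (y, z) ∈ N}`. -/
def RelDouble : DoubleCategory.{u + 1, u, u, u} (Type u) where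
  Hor X Y := SetRel X Y
  Cell R S := RelSquare R S
  vid R := ⟨𝟙 _, 𝟙 _, by rintro _ ⟨p, hp, rfl⟩; exact hp⟩
  vcomp α β := ⟨α.left ≫ β.left, α.right ≫ β.right, by
    rintro _ ⟨p, hp, rfl⟩
    exact β.image_subset ⟨_, α.image_subset ⟨p, hp, rfl⟩, rfl⟩⟩
  vid_vcomp _ := rfl
  vcomp_vid _ := rfl
  vassoc _ _ _ := rfl
  src α := α.left
  tgt α := α.right
  src_vid _ := rfl
  tgt_vid _ := rfl
  src_vcomp _ _ := rfl
  tgt_vcomp _ _ := rfl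
  U X := SetRel.id
  UMap f := ⟨f, f, by rintro _ ⟨⟨x, y⟩, hp, rfl⟩; exact congrArg f hp⟩
  src_UMap _ := rfl
  tgt_UMap _ := rfl
  UMap_id _ := rfl
  UMap_comp _ _ := rfl
  hcomp N M := SetRel.comp M N
  hcompCell β α h := ⟨α.left, β.right, by
    rintro _ ⟨⟨x, z⟩, ⟨y, hxy, hyz⟩, rfl⟩
    refine ⟨α.right y, α.image_subset ⟨_, hxy, rfl⟩, ?_⟩
    rw [h]
    exact β.image_subset ⟨_, hyz, rfl⟩⟩
  src_hcompCell _ _ _ := rfl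
  tgt_hcompCell _ _ _ := rfl
  hcompCell_vid _ _ := rfl
  hcompCell_vcomp _ _ _ _ _ _ := rfl
  assoc P N M := ⟨𝟙 _, 𝟙 _, by
    rintro _ ⟨⟨x, z⟩, ⟨y, hxy, y', h, h'⟩, rfl⟩; exact ⟨y', ⟨y, hxy, h⟩, h'⟩⟩
  assocInv P N M := ⟨𝟙 _, 𝟙 _, by
    rintro _ ⟨⟨x, z⟩, ⟨y, ⟨y', h, h'⟩, hxy⟩, rfl⟩; exact ⟨y', h, y, h', hxy⟩⟩
  assoc_assocInv _ _ _ := rfl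
  assocInv_assoc _ _ _ := rfl
  src_assoc _ _ _ := rfl
  tgt_assoc _ _ _ := rfl
  assoc_naturality _ _ _ _ _ := rfl
  lunit M := ⟨𝟙 _, 𝟙 _, by
    rintro _ ⟨⟨x, z⟩, ⟨y, h, h'⟩, rfl⟩; obtain rfl : y = z := h'; exact h⟩
  lunitInv M := ⟨𝟙 _, 𝟙 _, by rintro _ ⟨⟨x, z⟩, h, rfl⟩; exact ⟨z, h, rfl⟩⟩
  lunit_lunitInv _ := rfl
  lunitInv_lunit _ := rfl
  src_lunit _ := rfl
  tgt_lunit _ := rfl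
  lunit_naturality _ := rfl
  runit M := ⟨𝟙 _, 𝟙 _, by
    rintro _ ⟨⟨x, z⟩, ⟨y, h, h'⟩, rfl⟩; obtain rfl : x = y := h; exact h'⟩
  runitInv M := ⟨𝟙 _, 𝟙 _, by rintro _ ⟨⟨x, z⟩, h, rfl⟩; exact ⟨x, rfl, h⟩⟩
  runit_runitInv _ := rfl
  runitInv_runit _ := rfl
  src_runit _ := rfl
  tgt_runit _ := rfl
  runit_naturality _ := rfl
  pentagon _ _ _ _ := rfl
  triangle _ _ := rfl

/-! ### Structured cospans -/

section StructuredCospans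

variable {A : Type u} [Category.{v} A] {X : Type u'} [Category.{v'} X] (L : A ⥤ X)

/-- A structured cospan `L a ⟶ x ⟵ L b`. -/
structure StructuredCospan (a b : A) where
  apex : X
  inp : L.obj a ⟶ apex
  out : L.obj b ⟶ apex

variable {L}

/-- A 2-morphism of structured cospans: a commutative diagram made of `L f`, `mid` and `L g`. -/
@[ext]
structure StructuredCospanMap {a b c d : A} (M : StructuredCospan L a b)
    (N : StructuredCospan L c d) where
  left : a ⟶ c
  right : b ⟶ d
  mid : M.apex ⟶ N.apex
  inp_mid : M.inp ≫ mid = L.map left ≫ N.inp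
  out_mid : M.out ≫ mid = L.map right ≫ N.out

theorem StructuredCospanMap.inp_mid_assoc {a b c d : A} {M : StructuredCospan L a b}
    {N : StructuredCospan L c d} (α : StructuredCospanMap M N) {x : X} (h : N.apex ⟶ x) :
    M.inp ≫ α.mid ≫ h = L.map α.left ≫ N.inp ≫ h := by
  rw [← Category.assoc, α.inp_mid, Category.assoc]

theorem StructuredCospanMap.out_mid_assoc {a b c d : A} {M : StructuredCospan L a b}
    {N : StructuredCospan L c d} (α : StructuredCospanMap M N) {x : X} (h : N.apex ⟶ x) :
    M.out ≫ α.mid ≫ h = L.map α.right ≫ N.out ≫ h := by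
  rw [← Category.assoc, α.out_mid, Category.assoc]

variable [HasPushouts X]

/-- Composition of structured cospans by pushout. -/
noncomputable abbrev StructuredCospan.comp {a b c : A} (N : StructuredCospan L b c)
    (M : StructuredCospan L a b) : StructuredCospan L a c where
  apex := pushout M.out N.inp
  inp := M.inp ≫ pushout.inl M.out N.inp
  out := N.out ≫ pushout.inr M.out N.inp

variable (L)

attribute [local simp] pushout.inl_desc pushout.inr_desc pushout.inl_desc_assoc
  pushout.inr_desc_assoc in
/-- The double category of structured cospans: objects and vertical 1-morphisms are those of `A`,
horizontal 1-cells are structured cospans, composed by (chosen) pushouts, and 2-morphisms are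
commutative diagrams. -/
noncomputable def structuredCospanDouble :
    DoubleCategory.{u, v, max u' v', max v v'} A where
  Hor a b := StructuredCospan L a b
  Cell M N := StructuredCospanMap M N
  vid M := ⟨𝟙 _, 𝟙 _, 𝟙 _, by simp, by simp⟩
  vcomp α β := ⟨α.left ≫ β.left, α.right ≫ β.right, α.mid ≫ β.mid,
    by simp [α.inp_mid_assoc, β.inp_mid], by simp [α.out_mid_assoc, β.out_mid]⟩
  vid_vcomp α := by ext <;> simp
  vcomp_vid α := by ext <;> simp
  vassoc α β γ := by ext <;> simp
  src α := α.left
  tgt α := α.right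
  src_vid _ := rfl
  tgt_vid _ := rfl
  src_vcomp _ _ := rfl
  tgt_vcomp _ _ := rfl
  U a := ⟨L.obj a, 𝟙 _, 𝟙 _⟩
  UMap f := ⟨f, f, L.map f, by simp, by simp⟩
  src_UMap _ := rfl
  tgt_UMap _ := rfl
  UMap_id a := by ext <;> simp
  UMap_comp f g := by ext <;> simp
  hcomp N M := N.comp M
  hcompCell {a b c a' b' c' N M N' M'} β α h :=
    { left := α.left
      right := β.right
      mid := pushout.map M.out N.inp M'.out N'.inp α.mid β.mid (L.map α.right)
        α.out_mid (by rw [β.inp_mid, h])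
      inp_mid := by simp [α.inp_mid_assoc]
      out_mid := by simp [β.out_mid_assoc] }
  src_hcompCell _ _ _ := rfl
  tgt_hcompCell _ _ _ := rfl
  hcompCell_vid N M := by ext <;> simp
  hcompCell_vcomp β α β' α' h h' := by ext <;> simp
  assoc P N M :=
    { left := 𝟙 _
      right := 𝟙 _
      mid := pushout.desc
        (pushout.inl _ _ ≫ pushout.inl _ _)
        (pushout.desc (pushout.inr _ _ ≫ pushout.inl _ _) (pushout.inr _ _)
          (by simpa using pushout.condition (f := N.out ≫ pushout.inr M.out N.inp) (g := P.inp)))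
        (by simp [pushout.condition_assoc])
      inp_mid := by simp
      out_mid := by simp }
  assocInv P N M :=
    { left := 𝟙 _
      right := 𝟙 _
      mid := pushout.desc
        (pushout.desc (pushout.inl _ _) (pushout.inl _ _ ≫ pushout.inr _ _)
          (by simpa using pushout.condition (f := M.out) (g := N.inp ≫ pushout.inl N.out P.inp)))
        (pushout.inr _ _ ≫ pushout.inr _ _)
        (by simp [pushout.condition_assoc])
      inp_mid := by simp
      out_mid := by simp }
  assoc_assocInv P N M := by ext <;> simp
  assocInv_assoc P N M := by ext <;> simp
  src_assoc _ _ _ := rfl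
  tgt_assoc _ _ _ := rfl
  assoc_naturality γ β α h h' := by ext <;> simp
  lunit M :=
    { left := 𝟙 _
      right := 𝟙 _
      mid := pushout.desc (𝟙 _) M.out (by simp)
      inp_mid := by simp
      out_mid := by simp }
  lunitInv M :=
    { left := 𝟙 _
      right := 𝟙 _
      mid := pushout.inl _ _
      inp_mid := by simp
      out_mid := by simp [pushout.condition] }
  lunit_lunitInv M := by ext <;> simp [pushout.condition]
  lunitInv_lunit M := by ext <;> simp
  src_lunit _ := rfl
  tgt_lunit _ := rfl
  lunit_naturality α := by ext <;> simp [α.out_mid]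
  runit M :=
    { left := 𝟙 _
      right := 𝟙 _
      mid := pushout.desc M.inp (𝟙 _) (by simp)
      inp_mid := by simp
      out_mid := by simp }
  runitInv M :=
    { left := 𝟙 _
      right := 𝟙 _
      mid := pushout.inr _ _
      inp_mid := by simp [← pushout.condition]
      out_mid := by simp }
  runit_runitInv M := by ext <;> simp [← pushout.condition]
  runitInv_runit M := by ext <;> simp
  src_runit _ := rfl
  tgt_runit _ := rfl
  runit_naturality α := by ext <;> simp [α.inp_mid]
  pentagon Q P N M := by ext <;> simp
  triangle N M := by ext <;> simp [pushout.condition]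

end StructuredCospans

/-! ### Petri nets -/

/-- The functor `ℕ[-]`: the underlying set of the free commutative monoid, that is, finite formal
linear combinations with natural number coefficients, and `ℕ[f]` the additive extension of `f`. -/
noncomputable def markings : Type u ⥤ Type u where
  obj X := X →₀ ℕ
  map f := ↾(Finsupp.mapDomain f)
  map_id _ := ConcreteCategory.hom_ext _ _ fun _ => Finsupp.mapDomain_id
  map_comp f g := ConcreteCategory.hom_ext _ _ fun x =>
    Finsupp.mapDomain_comp (v := x) (f := (f : _ → _)) (g := (g : _ → _))

/-- A Petri net: a pair of functions `s, t : T → ℕ[S]`. -/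
structure Petri : Type (u + 1) where
  /-- Transitions. -/
  T : Type u
  /-- Places. -/
  S : Type u
  /-- The source function. -/
  s : T ⟶ markings.obj S
  /-- The target function. -/
  t : T ⟶ markings.obj S

/-- A morphism of Petri nets: functions on transitions and on places, commuting with sources and
with targets. -/
@[ext]
structure Petri.Hom (P Q : Petri.{u}) where
  onT : P.T ⟶ Q.T
  onS : P.S ⟶ Q.S
  onT_s : onT ≫ Q.s = P.s ≫ markings.map onS
  onT_t : onT ≫ Q.t = P.t ≫ markings.map onS

instance : Category.{u} Petri.{u} where
  Hom := Petri.Hom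
  id P := ⟨𝟙 _, 𝟙 _, by simp, by simp⟩
  comp f g := ⟨f.onT ≫ g.onT, f.onS ≫ g.onS,
    by rw [Category.assoc, g.onT_s, ← Category.assoc, f.onT_s, Category.assoc, Functor.map_comp],
    by rw [Category.assoc, g.onT_t, ← Category.assoc, f.onT_t, Category.assoc, Functor.map_comp]⟩

/-- The functor `L : Set ⥤ Petri` sending `X` to the Petri net with set of places `X` and without
transitions. -/
def discretePetri : Type u ⥤ Petri.{u} where
  obj X := ⟨PEmpty, X, ↾PEmpty.elim, ↾PEmpty.elim⟩
  map f := ⟨𝟙 _, f, by ext x; exact x.elim, by ext x; exact x.elim⟩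

/-- Pushouts in `Petri` are computed on transitions and on places. -/
instance : HasPushouts Petri.{u} := by
  refine @hasPushouts_of_hasColimit_span _ _ fun {W P Q f g} => ?_
  have hS : f.onS ≫ pushout.inl f.onS g.onS = g.onS ≫ pushout.inr f.onS g.onS := pushout.condition
  let R : Petri.{u} :=
    { T := pushout f.onT g.onT
      S := pushout f.onS g.onS
      s := pushout.desc (P.s ≫ markings.map (pushout.inl _ _)) (Q.s ≫ markings.map (pushout.inr _ _))
        (by rw [← Category.assoc, ← Category.assoc, f.onT_s, g.onT_s, Category.assoc,
              Category.assoc, ← Functor.map_comp, ← Functor.map_comp, hS])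
      t := pushout.desc (P.t ≫ markings.map (pushout.inl _ _)) (Q.t ≫ markings.map (pushout.inr _ _))
        (by rw [← Category.assoc, ← Category.assoc, f.onT_t, g.onT_t, Category.assoc,
              Category.assoc, ← Functor.map_comp, ← Functor.map_comp, hS]) }
  let l : P ⟶ R := ⟨pushout.inl _ _, pushout.inl _ _, pushout.inl_desc _ _ _, pushout.inl_desc _ _ _⟩
  let r : Q ⟶ R := ⟨pushout.inr _ _, pushout.inr _ _, pushout.inr_desc _ _ _, pushout.inr_desc _ _ _⟩
  have w : f ≫ l = g ≫ r := Petri.Hom.ext pushout.condition pushout.condition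
  have comm : ∀ {Z : Petri.{u}} (h : P ⟶ Z) (k : Q ⟶ Z) (e : f ≫ h = g ≫ k),
      ∃ d : R ⟶ Z, l ≫ d = h ∧ r ≫ d = k := by
    intro Z h k e
    refine ⟨⟨pushout.desc h.onT k.onT (congrArg Petri.Hom.onT e),
      pushout.desc h.onS k.onS (congrArg Petri.Hom.onS e), ?_, ?_⟩, ?_, ?_⟩
    · apply pushout.hom_ext
      · rw [pushout.inl_desc_assoc, pushout.inl_desc_assoc, Category.assoc, ← Functor.map_comp,
          pushout.inl_desc, h.onT_s]
      · rw [pushout.inr_desc_assoc, pushout.inr_desc_assoc, Category.assoc, ← Functor.map_comp,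
          pushout.inr_desc, k.onT_s]
    · apply pushout.hom_ext
      · rw [pushout.inl_desc_assoc, pushout.inl_desc_assoc, Category.assoc, ← Functor.map_comp,
          pushout.inl_desc, h.onT_t]
      · rw [pushout.inr_desc_assoc, pushout.inr_desc_assoc, Category.assoc, ← Functor.map_comp,
          pushout.inr_desc, k.onT_t]
    · exact Petri.Hom.ext (pushout.inl_desc _ _ _) (pushout.inl_desc _ _ _)
    · exact Petri.Hom.ext (pushout.inr_desc _ _ _) (pushout.inr_desc _ _ _)
  have uniq : ∀ {Z : Petri.{u}} (d e : R ⟶ Z), l ≫ d = l ≫ e → r ≫ d = r ≫ e → d = e :=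
    fun d e h k => Petri.Hom.ext
      (pushout.hom_ext (congrArg Petri.Hom.onT h) (congrArg Petri.Hom.onT k))
      (pushout.hom_ext (congrArg Petri.Hom.onS h) (congrArg Petri.Hom.onS k))
  exact ⟨⟨⟨PushoutCocone.mk l r w, PushoutCocone.IsColimit.mk w
    (fun s => (comm s.inl s.inr s.condition).choose)
    (fun s => (comm s.inl s.inr s.condition).choose_spec.1)
    (fun s => (comm s.inl s.inr s.condition).choose_spec.2)
    (fun s m h k => uniq _ _
      (h.trans (comm s.inl s.inr s.condition).choose_spec.1.symm)
      (k.trans (comm s.inl s.inr s.condition).choose_spec.2.symm))⟩⟩⟩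

/-- An open Petri net `P : X ⇸ Y`: a cospan `L X ⟶ P ⟵ L Y` in `Petri`. -/
abbrev OpenPetri (X Y : Type u) := StructuredCospan discretePetri.{u} X Y

/-- The double category `Open(Petri)` of sets, functions, open Petri nets (composed by pushout) and
commutative diagrams. -/
noncomputable abbrev OpenPetriDouble : DoubleCategory.{u + 1, u, u + 1, u} (Type u) :=
  structuredCospanDouble discretePetri.{u}

/-! ### Reachability -/

/-- The source `s(τ)` of a transition, as a finitely supported function. -/
def Petri.source (P : Petri.{u}) (τ : P.T) : P.S →₀ ℕ := P.s τ

/-- The target `t(τ)` of a transition, as a finitely supported function. -/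
def Petri.target (P : Petri.{u}) (τ : P.T) : P.S →₀ ℕ := P.t τ

/-- `(τ, m, n)` is a firing of the transition `τ`: `m ≥ s(τ)` and `n + s(τ) = m + t(τ)`. -/
def Petri.IsFiring (P : Petri.{u}) (τ : P.T) (m n : P.S →₀ ℕ) : Prop :=
  P.source τ ≤ m ∧ n + P.source τ = m + P.target τ

/-- The marking `n` is reachable from `m`: there is a finite (possibly empty) sequence of firings
leading from `m` to `n`. -/
def Petri.Reachable (P : Petri.{u}) (m n : P.S →₀ ℕ) : Prop :=
  Relation.ReflTransGen (fun m' n' => ∃ τ : P.T, P.IsFiring τ m' n') m n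

/-- The reachability relation of `L X --i--> P <--o-- L Y`: all pairs `(x, y)` in `ℕ[X] × ℕ[Y]` such
that `o(y)` is reachable from `i(x)`. -/
def OpenPetri.reachability {X Y : Type u} (P : OpenPetri X Y) :
    SetRel (markings.obj X) (markings.obj Y) :=
  {p | P.apex.Reachable (markings.map P.inp.onS p.1) (markings.map P.out.onS p.2)}

end OpenPetriNets

open OpenPetriNets

namespace OpenPetriNets

/-! A run of a net is a chain of firings, and both kinds of data in a firing are preserved by
`ℕ[g]`: it is additive, so it preserves the firing equation, and it is monotone, so it preserves
`s(τ) ≤ m`. Hence net morphisms carry runs to runs (`Petri.Reachable.map`).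

The rest follows from this. Applied to the middle leg of a 2-morphism, it gives the action on
squares. Applied to the two pushout injections, it turns a run of `P` followed by a run of `Q` into
one run of the glued net, because the pushout square identifies the two images of the intermediate
marking. The empty run gives the unit comparison. The composition comparison is only an inclusion:
in the glued net a token may cross the shared places several times, which no single run of `P`
followed by one of `Q` can imitate.

Squares in the double category of relations are determined by their vertical sides, so every
coherence law reduces to functoriality of `ℕ[-]`. -/

/-! ### Net morphisms preserve firings and runs -/

theorem Petri.Hom.source_onT {P Q : Petri.{u}} (h : P ⟶ Q) (τ : P.T) :
    Q.source (h.onT τ) = (P.source τ).mapDomain h.onS :=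
  ConcreteCategory.congr_hom h.onT_s τ

theorem Petri.Hom.target_onT {P Q : Petri.{u}} (h : P ⟶ Q) (τ : P.T) :
    Q.target (h.onT τ) = (P.target τ).mapDomain h.onS :=
  ConcreteCategory.congr_hom h.onT_t τ

/-- Morphisms of Petri nets preserve firings. -/
theorem Petri.IsFiring.map {P Q : Petri.{u}} (h : P ⟶ Q) {τ : P.T} {m n : P.S →₀ ℕ}
    (hτ : P.IsFiring τ m n) :
    Q.IsFiring (h.onT τ) (m.mapDomain h.onS) (n.mapDomain h.onS) := by
  obtain ⟨hle, heq⟩ := hτ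
  rw [Petri.IsFiring, Petri.Hom.source_onT, Petri.Hom.target_onT, ← Finsupp.mapDomain_add,
    ← Finsupp.mapDomain_add, heq]
  -- Writing `m = s(τ) + k` reduces monotonicity of `mapDomain` to its additivity.
  obtain ⟨k, rfl⟩ := exists_add_of_le hle
  rw [Finsupp.mapDomain_add (v₁ := P.source τ)]
  exact ⟨le_self_add, rfl⟩

/-- Morphisms of Petri nets preserve reachability. -/
theorem Petri.Reachable.map {P Q : Petri.{u}} (h : P ⟶ Q) {m n : P.S →₀ ℕ}
    (hr : P.Reachable m n) :
    Q.Reachable (m.mapDomain h.onS) (n.mapDomain h.onS) :=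
  Relation.ReflTransGen.lift (Finsupp.mapDomain h.onS)
    (fun _ _ ⟨τ, hτ⟩ => ⟨h.onT τ, hτ.map h⟩) _ _ hr

/-! ### Reachability relations of open nets -/

theorem markings_map_map {X Y Z : Type u} (f : X ⟶ Y) (g : Y ⟶ Z) (x : markings.obj X) :
    markings.map g (markings.map f x) = markings.map (f ≫ g) x :=
  ConcreteCategory.congr_hom (markings.map_comp f g).symm x

/-- Turns a commuting square of nets, read on places, into an equality of markings; this is how
endpoints of transported runs are identified. -/
theorem markings_map_map_eq {X Y Y' Z : Type u} {f : X ⟶ Y} {g : Y ⟶ Z} {f' : X ⟶ Y'}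
    {g' : Y' ⟶ Z} (h : f ≫ g = f' ≫ g') (x : markings.obj X) :
    markings.map g (markings.map f x) = markings.map g' (markings.map f' x) := by
  rw [markings_map_map, markings_map_map, h]

/-- The middle leg of `α` transports the run, and the commutation of `α` with the input and output
legs says that its endpoints are the required ones. On places, `discretePetri.map α.left` is
`α.left` itself. -/
theorem StructuredCospanMap.map_mem_reachability {X Y X' Y' : Type u} {P : OpenPetri X Y}
    {P' : OpenPetri X' Y'} (α : StructuredCospanMap P P') {x : markings.obj X}
    {y : markings.obj Y} (h : (x, y) ∈ OpenPetri.reachability P) :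
    (markings.map α.left x, markings.map α.right y) ∈ OpenPetri.reachability P' := by
  have hr := Petri.Reachable.map α.mid h
  have hi := markings_map_map_eq (congrArg Petri.Hom.onS α.inp_mid) x
  have ho := markings_map_map_eq (congrArg Petri.Hom.onS α.out_mid) y
  exact (congrArg₂ P'.apex.Reachable hi ho).mp hr

/-- Both runs are pushed into the pushout and concatenated. -/
theorem OpenPetri.comp_reachability_subset {X Y Z : Type u} (P : OpenPetri X Y)
    (Q : OpenPetri Y Z) :
    SetRel.comp (reachability P) (reachability Q) ⊆ reachability (Q.comp P) := by
  rintro ⟨x, z⟩ ⟨y, hxy, hyz⟩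
  have h₁ := Petri.Reachable.map (pushout.inl P.out Q.inp) hxy
  have h₂ := Petri.Reachable.map (pushout.inr P.out Q.inp) hyz
  -- The junction: the first run ends at the image of `y` through `P.out`, the second starts at its
  -- image through `Q.inp`, and these agree in the pushout.
  have e := markings_map_map_eq
    (congrArg Petri.Hom.onS (pushout.condition (f := P.out) (g := Q.inp))) y
  have hi := markings_map_map P.inp.onS (pushout.inl P.out Q.inp).onS x
  have ho := markings_map_map Q.out.onS (pushout.inr P.out Q.inp).onS z
  have h₁' := (congrArg₂ (pushout P.out Q.inp).Reachable hi e).mp h₁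
  have h₂' := (congrArg ((pushout P.out Q.inp).Reachable _) ho).mp h₂
  exact Relation.ReflTransGen.trans h₁' h₂'

/-- The lax double functor sending an open Petri net to its reachability relation. -/
noncomputable def reachabilityFunctor : LaxDoubleFunctor OpenPetriDouble.{u} RelDouble.{u} where
  F₀ := markings
  hor P := OpenPetri.reachability P
  cell α :=
    { left := markings.map (StructuredCospanMap.left α)
      right := markings.map (StructuredCospanMap.right α)
      image_subset := by
        rintro _ ⟨p, hp, rfl⟩
        exact StructuredCospanMap.map_mem_reachability α hp }
  -- The inclusion carried by a square is a proposition, so equality of squares is checked on the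
  -- two sides.
  cell_vid _ := RelSquare.ext (markings.map_id _) (markings.map_id _)
  cell_vcomp _ _ := RelSquare.ext (markings.map_comp _ _) (markings.map_comp _ _)
  src_cell _ := rfl
  tgt_cell _ := rfl
  compar N M :=
    { left := 𝟙 _
      right := 𝟙 _
      image_subset := by
        rintro _ ⟨p, hp, rfl⟩
        exact OpenPetri.comp_reachability_subset M N hp }
  src_compar _ _ := rfl
  tgt_compar _ _ := rfl
  compar_naturality _ _ _ := rfl
  unitCompar a :=
    { left := 𝟙 _
      right := 𝟙 _
      image_subset := by
        rintro _ ⟨⟨x, y⟩, hp, rfl⟩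
        obtain rfl : x = y := hp
        -- Both legs of the unit cospan are the same identity, so the two endpoints coincide and the
        -- empty run suffices.
        exact Relation.ReflTransGen.refl }
  src_unitCompar _ := rfl
  tgt_unitCompar _ := rfl
  unitCompar_naturality _ := rfl
  -- All comparisons and structure cells have identity sides; the one thing left to simplify is
  -- `markings.map (𝟙 _)`, from the image of the associator or unitor.
  compar_assoc _ _ _ := RelSquare.ext (markings.map_id _) (markings.map_id _)
  compar_runit _ := RelSquare.ext (markings.map_id _) (markings.map_id _)
  compar_lunit _ := RelSquare.ext (markings.map_id _) (markings.map_id _)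

end OpenPetriNets

/-- The equation on `toOneCellMap` fixes the values on sets, functions and open nets. The action on
2-morphisms is then forced: `src_cell` and `tgt_cell` prescribe the sides, and a square of relations
has no further data. -/
theorem mainTheorem4 :
    (∃ B : LaxDoubleFunctor OpenPetriDouble.{u} RelDouble.{u},
      B.toOneCellMap = ⟨markings.{u}, fun P => OpenPetri.reachability P⟩) ∧
    (∀ {X Y X' Y' : Type u} {P : OpenPetri X Y} {P' : OpenPetri X' Y'}
      (α : StructuredCospanMap P P') (x : markings.obj X) (y : markings.obj Y),
      (x, y) ∈ OpenPetri.reachability P →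
        (markings.map α.left x, markings.map α.right y) ∈ OpenPetri.reachability P') ∧
    (∀ {X Y Z : Type u} (P : OpenPetri X Y) (Q : OpenPetri Y Z),
      SetRel.comp (OpenPetri.reachability P) (OpenPetri.reachability Q) ⊆
        OpenPetri.reachability (Q.comp P)) :=
  ⟨⟨reachabilityFunctor, rfl⟩, fun α _ _ h => α.map_mem_reachability h,
    fun P Q => OpenPetri.comp_reachability_subset P Q⟩
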